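/- Let $X_0,X_1$ be complex Banach spaces, continuously and linearly embedded in a Hausdorff topological vector space, such that $\Delta=X_0\cap X_1$ is dense in $X_0$ and in $X_1$. Let $\Sigma=X_0+X_1$ with the norm $\|x\|_\Sigma=\inf\{\|x_0\|_0+\|x_1\|_1: x=x_0+x_1\}$. Let $\mathcal H$ be the space of functions $g:\{z\in\mathbb C:0\le\operatorname{Re}z\le1\}\to\Sigma$ that are bounded and continuous, analytic for $0<\operatorname{Re}z<1$, and such that $t\mapsto g(j+it)$ is a bounded continuous map $\mathbb R\to X_j$ for $j=0,1$, with the norm $\|g\|_{\mathcal H}=\sup\{\|g(j+it)\|_j: j=0,1,\ t\in\mathbb R\}$. For $0<\theta<1$ let $X_\theta=\{g(\theta):g\in\mathcal H\}$ with $\|x\|_\theta=\inf\{\|g\|_{\mathcal H}: g(\theta)=x\}$. Let $B_\theta:X_\theta\to\mathcal H$ be any map with $B_\theta(x)(\theta)=x$ and $B_\theta(\lambda x)=\lambda B_\theta(x)$ $(\lambda\in\mathbb C)$ for which there is a constant $C$ with $\|B_\theta(x)\|_{\mathcal H}\le C\|x\|_\theta$ for all $x\in X_\theta$. Put $\Omega_\theta(x)=B_\theta(x)'(\theta)\in\Sigma$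 and $$d_{\Omega_\theta}X_\theta=\{(w,x)\in\Sigma\times X_\theta:\ w-\Omega_\theta x\in X_\theta\},\qquad \|(w,x)\|=\|x\|_\theta+\|w-\Omega_\theta x\|_\theta .$$ Let $u:\Sigma\to\Sigma$ be a real-linear operator that acts boundedly on the scale, i.e. $u$ maps $X_0$ into $X_0$ and $X_1$ into $X_1$ and is bounded for the norms of $X_0$ and of $X_1$, and suppose that $u$ is a complex structure, i.e. $u(u(x))=-x$ for all $x\in X_\theta$. Then $d_{\Omega_\theta}X_\theta$ is a linear subspace of $\Sigma\times X_\theta$, $\|(w,x)\|$ is a quasi-norm on it, and $(u,u):(w,x)\mapsto(u(w),u(x))$ is a complex structure on it: it maps $d_{\Omega_\theta}X_\theta$ into itself, is real-linear and bounded for the quasi-norm, and its square is $-\mathrm{id}$. -/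

import Mathlib

open scoped BoundedContinuousFunction

noncomputable section

/-- A compatible couple of complex Banach spaces: both are continuously embedded in a Hausdorff
topological vector space `V`, and their intersection is dense in each of them. -/
structure CompatibleCouple (X₀ X₁ V : Type*)
    [NormedAddCommGroup X₀] [NormedSpace ℂ X₀] [NormedAddCommGroup X₁] [NormedSpace ℂ X₁]
    [AddCommGroup V] [Module ℂ V] [TopologicalSpace V] where
  /-- the embedding of `X₀` -/
  i₀ : X₀ →L[ℂ] V
  /-- the embedding of `X₁` -/
  i₁ : X₁ →L[ℂ] V
  injective₀ : Function.Injective i₀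
  injective₁ : Function.Injective i₁
  dense₀ : Dense {x : X₀ | ∃ y : X₁, i₁ y = i₀ x}
  dense₁ : Dense {y : X₁ | ∃ x : X₀, i₀ x = i₁ y}

namespace CompatibleCouple

variable {X₀ X₁ V : Type*}
  [NormedAddCommGroup X₀] [NormedSpace ℂ X₀] [NormedAddCommGroup X₁] [NormedSpace ℂ X₁]
  [AddCommGroup V] [Module ℂ V] [TopologicalSpace V] [IsTopologicalAddGroup V] [T2Space V]

/-- The map `(x₀, x₁) ↦ x₀ + x₁` into `V`, where `X₀ × X₁` has the norm `‖x₀‖ + ‖x₁‖`. -/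
def addMap (X : CompatibleCouple X₀ X₁ V) : WithLp 1 (X₀ × X₁) →L[ℂ] V :=
  (X.i₀.coprod X.i₁).comp (WithLp.prodContinuousLinearEquiv 1 ℂ X₀ X₁).toContinuousLinearMap

/-- The pairs with `x₀ + x₁ = 0`. -/
def addKer (X : CompatibleCouple X₀ X₁ V) : Submodule ℂ (WithLp 1 (X₀ × X₁)) :=
  LinearMap.ker (X.addMap : WithLp 1 (X₀ × X₁) →ₗ[ℂ] V)

instance isClosed_addKer (X : CompatibleCouple X₀ X₁ V) :
    IsClosed (X.addKer : Set (WithLp 1 (X₀ × X₁))) :=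
  isClosed_singleton.preimage X.addMap.continuous

/-- The sum `Σ = X₀ + X₁`, realized as `X₀ × X₁` modulo the pairs with `x₀ + x₁ = 0` in `V`. The
addition map identifies it with the subspace `X₀ + X₁` of `V`, and its quotient norm is
`‖x‖ = inf {‖x₀‖ + ‖x₁‖ : x = x₀ + x₁}`. -/
def Sum (X : CompatibleCouple X₀ X₁ V) : Type _ := WithLp 1 (X₀ × X₁) ⧸ X.addKer

instance (X : CompatibleCouple X₀ X₁ V) : NormedAddCommGroup X.Sum :=
  inferInstanceAs (NormedAddCommGroup (WithLp 1 (X₀ × X₁) ⧸ X.addKer))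

instance (X : CompatibleCouple X₀ X₁ V) : NormedSpace ℂ X.Sum :=
  inferInstanceAs (NormedSpace ℂ (WithLp 1 (X₀ × X₁) ⧸ X.addKer))

/-- The inclusion of `X₀` in `Σ`. -/
def incl₀ (X : CompatibleCouple X₀ X₁ V) : X₀ →ₗ[ℂ] X.Sum :=
  X.addKer.mkQ ∘ₗ (WithLp.linearEquiv 1 ℂ (X₀ × X₁)).symm.toLinearMap ∘ₗ LinearMap.inl ℂ X₀ X₁

/-- The inclusion of `X₁` in `Σ`. -/
def incl₁ (X : CompatibleCouple X₀ X₁ V) : X₁ →ₗ[ℂ] X.Sum :=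
  X.addKer.mkQ ∘ₗ (WithLp.linearEquiv 1 ℂ (X₀ × X₁)).symm.toLinearMap ∘ₗ LinearMap.inr ℂ X₀ X₁

/-- The space `𝓗(X₀, X₁)`. An element is a function `g` on the closed strip `0 ≤ Re z ≤ 1` with
values in `Σ` (extended by `0` to `ℂ`), bounded and continuous on the closed strip and analytic on
the open strip, recorded together with its two boundary functions `t ↦ g(it)` and `t ↦ g(1 + it)`,
which have to be bounded and continuous with values in `X₀` and `X₁`. The boundary functions are
determined by `g`. -/
def calderon (X : CompatibleCouple X₀ X₁ V) :
    Submodule ℂ ((ℂ → X.Sum) × (ℝ →ᵇ X₀) × (ℝ →ᵇ X₁)) where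
  carrier := {p |
    (∀ z, z ∉ Complex.re ⁻¹' Set.Icc 0 1 → p.1 z = 0) ∧
    (∃ M : ℝ, ∀ z, ‖p.1 z‖ ≤ M) ∧
    ContinuousOn p.1 (Complex.re ⁻¹' Set.Icc 0 1) ∧
    DifferentiableOn ℂ p.1 (Complex.re ⁻¹' Set.Ioo 0 1) ∧
    (∀ t : ℝ, p.1 (t * Complex.I) = X.incl₀ (p.2.1 t)) ∧
    (∀ t : ℝ, p.1 (1 + t * Complex.I) = X.incl₁ (p.2.2 t))}
  zero_mem' := by
    refine ⟨fun _ _ => rfl, ⟨0, fun _ => by simp⟩, continuousOn_const, ?_, ?_, ?_⟩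
    · exact differentiableOn_const 0
    · intro t; simp
    · intro t; simp
  add_mem' := by
    rintro p q ⟨hp, ⟨M, hM⟩, hpc, hpd, hp0, hp1⟩ ⟨hq, ⟨N, hN⟩, hqc, hqd, hq0, hq1⟩
    refine ⟨fun z hz => ?_, ⟨M + N, fun z => ?_⟩, hpc.add hqc, hpd.add hqd, fun t => ?_,
      fun t => ?_⟩
    · simp [hp z hz, hq z hz]
    · exact (norm_add_le _ _).trans (add_le_add (hM z) (hN z))
    · simp [hp0 t, hq0 t]
    · simp [hp1 t, hq1 t]
  smul_mem' := by
    rintro c p ⟨hp, ⟨M, hM⟩, hpc, hpd, hp0, hp1⟩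
    refine ⟨fun z hz => ?_, ⟨‖c‖ * M, fun z => ?_⟩, hpc.const_smul c, hpd.const_smul c,
      fun t => ?_, fun t => ?_⟩
    · simp [hp z hz]
    · simpa [norm_smul] using mul_le_mul_of_nonneg_left (hM z) (norm_nonneg c)
    · simp [hp0 t]
    · simp [hp1 t]

/-- The norm of `𝓗`: the larger of `sup_t ‖g(it)‖₀` and `sup_t ‖g(1 + it)‖₁`. -/
def calderonNorm (X : CompatibleCouple X₀ X₁ V) (g : X.calderon) : ℝ :=
  max ‖g.1.2.1‖ ‖g.1.2.2‖

/-- Evaluation `δ_θ : 𝓗 → Σ`, `g ↦ g(θ)`. -/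
def eval (X : CompatibleCouple X₀ X₁ V) (θ : ℝ) : X.calderon →ₗ[ℂ] X.Sum :=
  LinearMap.proj (θ : ℂ) ∘ₗ LinearMap.fst ℂ (ℂ → X.Sum) ((ℝ →ᵇ X₀) × (ℝ →ᵇ X₁)) ∘ₗ
    X.calderon.subtype

/-- Evaluation of the derivative `δ'_θ : 𝓗 → Σ`, `g ↦ g'(θ)`. -/
def evalDeriv (X : CompatibleCouple X₀ X₁ V) (θ : ℝ) (g : X.calderon) : X.Sum :=
  deriv g.1.1 (θ : ℂ)

/-- The complex interpolation space `X_θ = {g(θ) : g ∈ 𝓗}`. -/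
def interp (X : CompatibleCouple X₀ X₁ V) (θ : ℝ) : Submodule ℂ X.Sum :=
  LinearMap.range (X.eval θ)

/-- The norm of `X_θ`: `‖x‖_θ = inf {‖g‖ : g ∈ 𝓗, g(θ) = x}`. -/
def interpNorm (X : CompatibleCouple X₀ X₁ V) (θ : ℝ) (x : X.interp θ) : ℝ :=
  sInf (X.calderonNorm '' {g | X.eval θ g = x})

/-- `B : X_θ → 𝓗` is a bounded homogeneous selection for `δ_θ`. -/
structure IsBoundedSelection (X : CompatibleCouple X₀ X₁ V) (θ : ℝ)
    (B : X.interp θ → X.calderon) : Prop where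
  eval_eq : ∀ x, X.eval θ (B x) = x
  homogeneous : ∀ (c : ℂ) x, B (c • x) = c • B x
  bounded : ∃ C : ℝ, ∀ x, X.calderonNorm (B x) ≤ C * X.interpNorm θ x

/-- The map `Ω_θ = δ'_θ B_θ : X_θ → Σ` induced by a selection. -/
def centralizer (X : CompatibleCouple X₀ X₁ V) (θ : ℝ) (B : X.interp θ → X.calderon)
    (x : X.interp θ) : X.Sum :=
  X.evalDeriv θ (B x)

/-- `d_Ω X_θ = {(w, x) : w ∈ Σ, x ∈ X_θ, w - Ω x ∈ X_θ}`. -/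
def derived (X : CompatibleCouple X₀ X₁ V) (θ : ℝ) (Ω : X.interp θ → X.Sum) :
    Set (X.Sum × X.interp θ) :=
  {p | p.1 - Ω p.2 ∈ X.interp θ}

/-- The functional `‖(w, x)‖ = ‖x‖_θ + ‖w - Ω x‖_θ` on `d_Ω X_θ`. -/
def derivedNorm (X : CompatibleCouple X₀ X₁ V) (θ : ℝ) (Ω : X.interp θ → X.Sum)
    (p : X.derived θ Ω) : ℝ :=
  X.interpNorm θ p.1.2 + X.interpNorm θ ⟨p.1.1 - Ω p.1.2, p.2⟩

/-- A real-linear operator on `Σ` acts boundedly on the scale if it restricts to bounded operators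
`X₀ → X₀` and `X₁ → X₁`. -/
structure IsOperatorOnScale (X : CompatibleCouple X₀ X₁ V) (u : X.Sum →ₗ[ℝ] X.Sum) : Prop where
  bounded₀ : ∃ C : ℝ, ∀ x : X₀, ∃ y : X₀, X.incl₀ y = u (X.incl₀ x) ∧ ‖y‖ ≤ C * ‖x‖
  bounded₁ : ∃ C : ℝ, ∀ x : X₁, ∃ y : X₁, X.incl₁ y = u (X.incl₁ x) ∧ ‖y‖ ≤ C * ‖x‖

end CompatibleCouple

/-- A quasi-norm on a complex vector space. -/
structure IsQuasiNorm {E : Type*} [AddCommGroup E] [Module ℂ E] (q : E → ℝ) : Prop where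
  nonneg : ∀ x, 0 ≤ q x
  eq_zero_iff : ∀ x, q x = 0 ↔ x = 0
  smul : ∀ (c : ℂ) x, q (c • x) = ‖c‖ * q x
  add_le : ∃ K : ℝ, ∀ x y, q (x + y) ≤ K * (q x + q y)

/-- A complex structure on a space with (quasi-)norm `q`: a bounded real-linear operator `β` with
`β² = -id`. -/
structure IsComplexStructure {E : Type*} [AddCommGroup E] [Module ℝ E] (q : E → ℝ)
    (β : E →ₗ[ℝ] E) : Prop where
  bounded : ∃ C : ℝ, ∀ x, q (β x) ≤ C * q x
  sq_eq_neg : ∀ x, β (β x) = -x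

end

noncomputable section

open Set Filter Topology

namespace CompatibleCouple

variable {X₀ X₁ V : Type*}
  [NormedAddCommGroup X₀] [NormedSpace ℂ X₀] [NormedAddCommGroup X₁] [NormedSpace ℂ X₁]
  [AddCommGroup V] [Module ℂ V] [TopologicalSpace V] [IsTopologicalAddGroup V] [T2Space V]
  (X : CompatibleCouple X₀ X₁ V)

/-! ### The sum space -/

/-! Everything follows from one principle: if `g ∈ 𝓗` vanishes at `θ`, then `g'(θ) ∈ X_θ` with
control of the norm, because `g(z)/(z - θ)` is again in `𝓗` and takes the value `g'(θ)` at `θ`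
(`exists_eval_eq_evalDeriv`). Hence two functions of `𝓗` with the same value at `θ` have derivatives
there that differ by an element of `X_θ`. Comparing `B x + B x'` with `B (x + x')` shows that `Ω_θ`
is quasi-additive, so the derived space is linear and its functional is a quasi-norm.

For `u`, the point is to lift a merely real-linear operator to `𝓗`. Write `u = L + A` with `L`
complex linear and `A` conjugate linear. Then `L ∘ g` is analytic, and so is `z ↦ A (g (conj z))`;
conjugation preserves the strip and both of its edges and fixes `θ`. The sum of the two is a lift of
`g` whose value and derivative at `θ` are `u (g(θ))` and `u (g'(θ))`
(`IsOperatorOnScale.exists_lift`). Comparing the lift of `B x` with `B (u x)` bounds the commutator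
`u Ω_θ - Ω_θ u`, and `u w - Ω_θ (u x) = u (w - Ω_θ x) + (u Ω_θ - Ω_θ u) x` gives boundedness of `(u,
u)`.

Finally, `w` ranges over `Σ`, whereas `u² = -1` is assumed only on `X_θ`; density of `Δ ⊆ X_θ` in
`X₀` and `X₁` extends the identity to `Σ`. -/

instance [CompleteSpace X₀] [CompleteSpace X₁] : CompleteSpace X.Sum :=
  inferInstanceAs (CompleteSpace (WithLp 1 (X₀ × X₁) ⧸ X.addKer))

lemma mk_eq_incl_add (x : X₀) (y : X₁) :
    (Submodule.Quotient.mk (WithLp.toLp 1 (x, y)) : X.Sum) = X.incl₀ x + X.incl₁ y := by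
  have h : WithLp.toLp 1 (x, y) = WithLp.toLp 1 (x, (0 : X₁)) + WithLp.toLp 1 ((0 : X₀), y) := by
    rw [← WithLp.toLp_add]; simp
  rw [h]
  rfl

lemma exists_incl_norm_lt (s : X.Sum) {ε : ℝ} (hε : 0 < ε) :
    ∃ x y, s = X.incl₀ x + X.incl₁ y ∧ ‖x‖ + ‖y‖ < ‖s‖ + ε := by
  obtain ⟨m, hm, hlt⟩ := Submodule.Quotient.norm_mk_lt (S := X.addKer) s hε
  refine ⟨m.fst, m.snd, ?_, ?_⟩
  · rw [← mk_eq_incl_add]; exact hm.symm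
  · have := WithLp.prod_norm_eq_of_L1 m
    rwa [this] at hlt

lemma norm_incl₀_le (x : X₀) : ‖X.incl₀ x‖ ≤ ‖x‖ := by
  have h := Submodule.Quotient.norm_mk_le X.addKer (WithLp.toLp 1 (x, (0 : X₁)))
  have h2 : ‖WithLp.toLp 1 (x, (0 : X₁))‖ = ‖x‖ := by
    simp
  rw [h2] at h
  exact h

lemma norm_incl₁_le (y : X₁) : ‖X.incl₁ y‖ ≤ ‖y‖ := by
  have h := Submodule.Quotient.norm_mk_le X.addKer (WithLp.toLp 1 ((0 : X₀), y))
  have h2 : ‖WithLp.toLp 1 ((0 : X₀), y)‖ = ‖y‖ := by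
    simp
  rw [h2] at h
  exact h

lemma continuous_incl₀ : Continuous X.incl₀ :=
  (X.incl₀.mkContinuous 1 fun x => by simpa using X.norm_incl₀_le x).continuous

lemma continuous_incl₁ : Continuous X.incl₁ :=
  (X.incl₁.mkContinuous 1 fun x => by simpa using X.norm_incl₁_le x).continuous

/-- The quotient is by the pairs with sum zero in `V`. This carries the injectivity and density
hypotheses, stated in `V`, over to `Σ`. -/
lemma incl₀_eq_incl₁_iff (x : X₀) (y : X₁) : X.incl₀ x = X.incl₁ y ↔ X.i₀ x = X.i₁ y := by
  have h : X.incl₀ x = X.incl₁ y ↔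
      WithLp.toLp 1 (x, (0 : X₁)) - WithLp.toLp 1 ((0 : X₀), y) ∈ X.addKer :=
    Submodule.Quotient.eq X.addKer
  rw [h, ← WithLp.toLp_sub, ← sub_eq_zero (a := X.i₀ x)]
  simp [addKer, addMap, sub_eq_add_neg]

lemma injective_incl₀ : Function.Injective X.incl₀ := by
  rw [injective_iff_map_eq_zero]
  intro x hx
  have h := (X.incl₀_eq_incl₁_iff x 0).1 (by simpa using hx)
  exact X.injective₀ (by simpa using h)

lemma injective_incl₁ : Function.Injective X.incl₁ := by
  rw [injective_iff_map_eq_zero]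
  intro y hy
  have h := (X.incl₀_eq_incl₁_iff 0 y).1 (by simpa using hy.symm)
  exact X.injective₁ (by simpa using h.symm)

/-! ### Operators on the scale -/

/-- A bounded operator between normed spaces obtained by restricting along injections. -/
lemma exists_restrict {E S : Type*} [NormedAddCommGroup E] [NormedSpace ℂ E] [AddCommGroup S]
    [Module ℂ S] [Module ℝ S] [IsScalarTower ℝ ℂ S] (i : E →ₗ[ℂ] S) (hi : Function.Injective i)
    (u : S →ₗ[ℝ] S) (h : ∃ C : ℝ, ∀ x : E, ∃ y : E, i y = u (i x) ∧ ‖y‖ ≤ C * ‖x‖) :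
    ∃ v : E →L[ℝ] E, ∀ x, i (v x) = u (i x) := by
  obtain ⟨C, hC⟩ := h
  choose f hf hfC using hC
  have hr : ∀ (r : ℝ) (x : E), i (r • x) = r • i x := fun r x =>
    (i.restrictScalars ℝ).map_smul r x
  -- The chosen `f` is real-linear because `i` is injective and intertwines it with `u`.
  refine ⟨LinearMap.mkContinuous
    { toFun := f
      map_add' := fun x y => hi (by simp [hf])
      map_smul' := fun r x => hi (by simp [hf, hr]) } C hfC, hf⟩

variable {X}

lemma IsOperatorOnScale.exists_restrict₀ {u : X.Sum →ₗ[ℝ] X.Sum} (hu : X.IsOperatorOnScale u) :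
    ∃ v : X₀ →L[ℝ] X₀, ∀ x, X.incl₀ (v x) = u (X.incl₀ x) :=
  exists_restrict X.incl₀ X.injective_incl₀ u hu.bounded₀

lemma IsOperatorOnScale.exists_restrict₁ {u : X.Sum →ₗ[ℝ] X.Sum} (hu : X.IsOperatorOnScale u) :
    ∃ v : X₁ →L[ℝ] X₁, ∀ x, X.incl₁ (v x) = u (X.incl₁ x) :=
  exists_restrict X.incl₁ X.injective_incl₁ u hu.bounded₁

lemma IsOperatorOnScale.of_restrict {u : X.Sum →ₗ[ℝ] X.Sum} (v₀ : X₀ →L[ℝ] X₀)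
    (v₁ : X₁ →L[ℝ] X₁) (h₀ : ∀ x, X.incl₀ (v₀ x) = u (X.incl₀ x))
    (h₁ : ∀ x, X.incl₁ (v₁ x) = u (X.incl₁ x)) : X.IsOperatorOnScale u :=
  ⟨⟨‖v₀‖, fun x => ⟨v₀ x, h₀ x, v₀.le_opNorm x⟩⟩, ⟨‖v₁‖, fun x => ⟨v₁ x, h₁ x, v₁.le_opNorm x⟩⟩⟩

/-- Apply the two restrictions to a decomposition that is optimal up to `ε`, then let `ε → 0`. -/
lemma IsOperatorOnScale.exists_bound {u : X.Sum →ₗ[ℝ] X.Sum} (hu : X.IsOperatorOnScale u) :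
    ∃ C : ℝ, ∀ s, ‖u s‖ ≤ C * ‖s‖ := by
  obtain ⟨v₀, h₀⟩ := hu.exists_restrict₀
  obtain ⟨v₁, h₁⟩ := hu.exists_restrict₁
  refine ⟨max ‖v₀‖ ‖v₁‖, fun s => ?_⟩
  have hC : 0 ≤ max ‖v₀‖ ‖v₁‖ := le_max_of_le_left (norm_nonneg _)
  have key : ∀ ε > 0, ‖u s‖ ≤ max ‖v₀‖ ‖v₁‖ * (‖s‖ + ε) := by
    intro ε hε
    obtain ⟨x, y, rfl, hlt⟩ := X.exists_incl_norm_lt s hε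
    rw [map_add, ← h₀, ← h₁]
    calc _ ≤ ‖v₀ x‖ + ‖v₁ y‖ :=
          (norm_add_le _ _).trans (add_le_add (X.norm_incl₀_le _) (X.norm_incl₁_le _))
      _ ≤ max ‖v₀‖ ‖v₁‖ * ‖x‖ + max ‖v₀‖ ‖v₁‖ * ‖y‖ :=
          add_le_add (v₀.le_of_opNorm_le (le_max_left _ _) x)
            (v₁.le_of_opNorm_le (le_max_right _ _) y)
      _ = max ‖v₀‖ ‖v₁‖ * (‖x‖ + ‖y‖) := by ring
      _ ≤ _ := mul_le_mul_of_nonneg_left hlt.le hC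
  have ht : Tendsto (fun ε : ℝ => max ‖v₀‖ ‖v₁‖ * (‖s‖ + ε)) (𝓝[>] 0)
      (𝓝 (max ‖v₀‖ ‖v₁‖ * (‖s‖ + 0))) :=
    ((by fun_prop : Continuous fun ε : ℝ => max ‖v₀‖ ‖v₁‖ * (‖s‖ + ε)).tendsto 0).mono_left
      nhdsWithin_le_nhds
  rw [add_zero] at ht
  exact ge_of_tendsto ht (eventually_nhdsWithin_of_forall key)

lemma IsOperatorOnScale.continuous {u : X.Sum →ₗ[ℝ] X.Sum} (hu : X.IsOperatorOnScale u) :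
    Continuous u := by
  obtain ⟨C, hC⟩ := hu.exists_bound
  exact (u.mkContinuous C hC).continuous

/-! ### The Calderón space -/

lemma calderonNorm_nonneg (g : X.calderon) : 0 ≤ X.calderonNorm g :=
  le_max_of_le_left (norm_nonneg _)

lemma calderonNorm_add_le (g h : X.calderon) :
    X.calderonNorm (g + h) ≤ X.calderonNorm g + X.calderonNorm h :=
  max_le ((norm_add_le _ _).trans (add_le_add (le_max_left _ _) (le_max_left _ _)))
    ((norm_add_le _ _).trans (add_le_add (le_max_right _ _) (le_max_right _ _)))

lemma calderonNorm_smul (c : ℂ) (g : X.calderon) :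
    X.calderonNorm (c • g) = ‖c‖ * X.calderonNorm g := by
  simp [calderonNorm, norm_smul, mul_max_of_nonneg]

lemma calderonNorm_sub_le (g h : X.calderon) :
    X.calderonNorm (g - h) ≤ X.calderonNorm g + X.calderonNorm h :=
  max_le ((norm_sub_le _ _).trans (add_le_add (le_max_left _ _) (le_max_left _ _)))
    ((norm_sub_le _ _).trans (add_le_add (le_max_right _ _) (le_max_right _ _)))

lemma isOpen_strip : IsOpen (Complex.re ⁻¹' Ioo (0 : ℝ) 1) :=
  isOpen_Ioo.preimage Complex.continuous_re

lemma calderon_differentiableAt (g : X.calderon) {z : ℂ} (hz : z ∈ Complex.re ⁻¹' Ioo (0 : ℝ) 1) :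
    DifferentiableAt ℂ g.1.1 z :=
  (g.2.2.2.2.1 z hz).differentiableAt (isOpen_strip.mem_nhds hz)

lemma ofReal_mem_strip {θ : ℝ} (hθ₀ : 0 < θ) (hθ₁ : θ < 1) :
    (θ : ℂ) ∈ Complex.re ⁻¹' Ioo (0 : ℝ) 1 := ⟨by simpa, by simpa⟩

lemma evalDeriv_add {θ : ℝ} (hθ₀ : 0 < θ) (hθ₁ : θ < 1) (g h : X.calderon) :
    X.evalDeriv θ (g + h) = X.evalDeriv θ g + X.evalDeriv θ h :=
  deriv_add (calderon_differentiableAt g (ofReal_mem_strip hθ₀ hθ₁))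
    (calderon_differentiableAt h (ofReal_mem_strip hθ₀ hθ₁))

lemma evalDeriv_smul {θ : ℝ} (hθ₀ : 0 < θ) (hθ₁ : θ < 1) (c : ℂ) (g : X.calderon) :
    X.evalDeriv θ (c • g) = c • X.evalDeriv θ g :=
  deriv_const_smul c (calderon_differentiableAt g (ofReal_mem_strip hθ₀ hθ₁))

lemma evalDeriv_sub {θ : ℝ} (hθ₀ : 0 < θ) (hθ₁ : θ < 1) (g h : X.calderon) :
    X.evalDeriv θ (g - h) = X.evalDeriv θ g - X.evalDeriv θ h :=
  deriv_sub (calderon_differentiableAt g (ofReal_mem_strip hθ₀ hθ₁))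
    (calderon_differentiableAt h (ofReal_mem_strip hθ₀ hθ₁))

/-- A bounded analytic function with zero boundary values on the strip vanishes. This gives
definiteness of the norm of `X_θ`. -/
lemma eval_eq_zero_of_calderonNorm_eq_zero {θ : ℝ} (hθ₀ : 0 < θ) (hθ₁ : θ < 1) (g : X.calderon)
    (hg : X.calderonNorm g = 0) : X.eval θ g = 0 := by
  obtain ⟨⟨f, g₀, g₁⟩, hz0, ⟨M, hM⟩, hc, hd, h0, h1⟩ := g
  have e0 : g₀ = 0 := norm_le_zero_iff.1 ((le_max_left _ _).trans hg.le)
  have e1 : g₁ = 0 := norm_le_zero_iff.1 ((le_max_right _ _).trans hg.le)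
  subst e0 e1
  have hcl : closure (Complex.re ⁻¹' Ioo (0 : ℝ) 1) = Complex.re ⁻¹' Icc 0 1 := by
    rw [Complex.closure_preimage_re, closure_Ioo zero_ne_one]
  -- Both growth parameters are `0`: the comparison function is constant, since `f` is bounded.
  refine PhragmenLindelof.eq_zero_on_vertical_strip (a := 0) (b := 1) (f := f) ⟨hd, ?_⟩
    ⟨0, by simpa using Real.pi_pos, 0, ?_⟩ ?_ ?_ (x := (θ : ℂ)) ⟨by simpa using hθ₀.le,
      by simpa using hθ₁.le⟩
  · rwa [hcl]
  · refine Asymptotics.IsBigO.of_bound M (Eventually.of_forall fun z => ?_)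
    simpa using hM z
  · intro z hz
    have : z = (z.im : ℂ) * Complex.I := by apply Complex.ext <;> simp [hz]
    rw [this]
    simpa using h0 z.im
  · intro z hz
    have : z = 1 + (z.im : ℂ) * Complex.I := by apply Complex.ext <;> simp [hz]
    rw [this]
    simpa using h1 z.im

/-- This is `Δ ⊆ X_θ`, witnessed by functions constant on the strip. -/
lemma incl_mem_interp {x : X₀} {y : X₁} (h : X.incl₀ x = X.incl₁ y) {θ : ℝ} (hθ₀ : 0 < θ)
    (hθ₁ : θ < 1) : X.incl₀ x ∈ X.interp θ := by
  classical
  let f : ℂ → X.Sum := (Complex.re ⁻¹' Icc (0 : ℝ) 1).indicator fun _ => X.incl₀ x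
  have hf : ∀ z ∈ Complex.re ⁻¹' Icc (0 : ℝ) 1, f z = X.incl₀ x := fun z hz =>
    indicator_of_mem hz _
  have hf0 : ∀ z ∉ Complex.re ⁻¹' Icc (0 : ℝ) 1, f z = 0 := fun z hz => indicator_of_notMem hz _
  refine ⟨⟨(f, .const ℝ x, .const ℝ y), hf0,
    ⟨‖X.incl₀ x‖, fun z => norm_indicator_le_norm_self (fun _ => X.incl₀ x) z⟩,
    continuousOn_const.congr hf,
    (differentiableOn_const (X.incl₀ x)).congr fun z hz => hf z ⟨hz.1.le, hz.2.le⟩,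
    fun t => hf _ (by simp), fun t => (hf _ (by simp)).trans h⟩, hf θ ⟨?_, ?_⟩⟩
  · simpa using hθ₀.le
  · simpa using hθ₁.le

/-! ### Extending `u² = -1` from `X_θ` to `Σ` -/

/-- An operator on the scale which squares to `-1` on some `X_θ` does so on all of `Σ`. -/
lemma IsOperatorOnScale.apply_apply_eq_neg {u : X.Sum →ₗ[ℝ] X.Sum} (hu : X.IsOperatorOnScale u)
    {θ : ℝ} (hθ₀ : 0 < θ) (hθ₁ : θ < 1) (h : ∀ x ∈ X.interp θ, u (u x) = -x) (s : X.Sum) :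
    u (u s) = -s := by
  have huc := hu.continuous
  obtain ⟨x, y, rfl, -⟩ := X.exists_incl_norm_lt s one_pos
  -- Both sides are continuous on `X₀` and agree on the dense subspace `Δ`, which lies in `X_θ`.
  have hx : (fun x => u (u (X.incl₀ x))) = fun x => -X.incl₀ x :=
    Continuous.ext_on X.dense₀ (huc.comp (huc.comp X.continuous_incl₀)) X.continuous_incl₀.neg
      (by
        rintro x ⟨y, hy⟩
        exact h _ (incl_mem_interp ((X.incl₀_eq_incl₁_iff x y).2 hy.symm) hθ₀ hθ₁))
  have hy : (fun y => u (u (X.incl₁ y))) = fun y => -X.incl₁ y :=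
    Continuous.ext_on X.dense₁ (huc.comp (huc.comp X.continuous_incl₁)) X.continuous_incl₁.neg
      (by
        rintro y ⟨x, hx⟩
        have e := (X.incl₀_eq_incl₁_iff x y).2 hx
        have := h _ (incl_mem_interp e hθ₀ hθ₁)
        rwa [e] at this)
  have hx' : u (u (X.incl₀ x)) = -X.incl₀ x := congrFun hx x
  have hy' : u (u (X.incl₁ y)) = -X.incl₁ y := congrFun hy y
  rw [map_add, map_add, hx', hy', neg_add]

/-! ### Dividing by `z - θ` in `𝓗` -/

/-- The derivative at `θ` of an element of the kernel of `δ_θ` belongs to `X_θ`. -/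
lemma exists_eval_eq_evalDeriv [CompleteSpace X₀] [CompleteSpace X₁] {θ : ℝ} (hθ₀ : 0 < θ)
    (hθ₁ : θ < 1) : ∃ C : ℝ, 0 ≤ C ∧ ∀ g : X.calderon, X.eval θ g = 0 →
      ∃ h : X.calderon, X.eval θ h = X.evalDeriv θ g ∧
        X.calderonNorm h ≤ C * X.calderonNorm g := by
  -- The distance from `θ` to the edges of the strip; dividing by `z - θ` costs at most `r⁻¹` there.
  set r : ℝ := min θ (1 - θ) with hr
  have hr0 : 0 < r := lt_min hθ₀ (by linarith)
  refine ⟨r⁻¹, by positivity, ?_⟩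
  rintro ⟨⟨f, g₀, g₁⟩, hz0, ⟨M, hM⟩, hc, hd, h0, h1⟩ hfθ
  replace hfθ : f θ = 0 := hfθ
  dsimp only at hz0 hM hc hd h0 h1
  have hmem := ofReal_mem_strip hθ₀ hθ₁
  have hnhds : Complex.re ⁻¹' Ioo (0 : ℝ) 1 ∈ 𝓝 (θ : ℂ) := isOpen_strip.mem_nhds hmem
  have hsub : Complex.re ⁻¹' Ioo (0 : ℝ) 1 ⊆ Complex.re ⁻¹' Icc (0 : ℝ) 1 :=
    preimage_mono Ioo_subset_Icc_self
  have hdθ : DifferentiableAt ℂ f θ := (hd _ hmem).differentiableAt hnhds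
  have hF : ∀ z ≠ (θ : ℂ), dslope f θ z = (z - θ)⁻¹ • f z := by
    intro z hz
    rw [dslope_of_ne _ hz, slope_def_module, hfθ, sub_zero]
  have hc' : ContinuousOn (dslope f θ) (Complex.re ⁻¹' Icc (0 : ℝ) 1) :=
    (continuousOn_dslope (mem_of_superset hnhds hsub)).2 ⟨hc, hdθ⟩
  -- Removable singularity at `θ`; completeness of `Σ` enters here.
  have hd' : DifferentiableOn ℂ (dslope f θ) (Complex.re ⁻¹' Ioo (0 : ℝ) 1) :=
    (Complex.differentiableOn_dslope hnhds).2 hd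
  have b0 : ∀ t : ℝ, r ≤ ‖(t : ℂ) * Complex.I - θ‖ := fun t => by
    have := Complex.abs_re_le_norm ((t : ℂ) * Complex.I - θ)
    simp only [Complex.sub_re, Complex.mul_re, Complex.ofReal_re, Complex.I_re, Complex.ofReal_im,
      Complex.I_im, mul_zero, zero_mul, sub_zero, zero_sub, abs_neg, abs_of_pos hθ₀] at this
    exact (min_le_left _ _).trans this
  have b1 : ∀ t : ℝ, r ≤ ‖1 + (t : ℂ) * Complex.I - θ‖ := fun t => by
    have := Complex.abs_re_le_norm (1 + (t : ℂ) * Complex.I - θ)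
    simp only [Complex.sub_re, Complex.add_re, Complex.one_re, Complex.mul_re, Complex.ofReal_re,
      Complex.I_re, Complex.ofReal_im, Complex.I_im, mul_zero, zero_mul, sub_zero,
      add_zero, abs_of_pos (sub_pos.2 hθ₁)] at this
    exact (min_le_right _ _).trans this
  have n0 : ∀ t : ℝ, (t : ℂ) * Complex.I - θ ≠ 0 := fun t =>
    norm_pos_iff.1 (hr0.trans_le (b0 t))
  have n1 : ∀ t : ℝ, 1 + (t : ℂ) * Complex.I - θ ≠ 0 := fun t =>
    norm_pos_iff.1 (hr0.trans_le (b1 t))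
  have bd0 : ∀ t : ℝ, ‖((t : ℂ) * Complex.I - θ)⁻¹ • g₀ t‖ ≤ r⁻¹ * ‖g₀‖ := fun t => by
    rw [norm_smul, norm_inv]
    exact mul_le_mul (inv_anti₀ hr0 (b0 t)) (g₀.norm_coe_le_norm t) (norm_nonneg _) (by positivity)
  have bd1 : ∀ t : ℝ, ‖(1 + (t : ℂ) * Complex.I - θ)⁻¹ • g₁ t‖ ≤ r⁻¹ * ‖g₁‖ := fun t => by
    rw [norm_smul, norm_inv]
    exact mul_le_mul (inv_anti₀ hr0 (b1 t)) (g₁.norm_coe_le_norm t) (norm_nonneg _) (by positivity)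
  let k₀ : ℝ →ᵇ X₀ := .ofNormedAddCommGroup (fun t => ((t : ℂ) * Complex.I - θ)⁻¹ • g₀ t)
    ((Continuous.inv₀ (by fun_prop) n0).smul g₀.continuous) _ bd0
  let k₁ : ℝ →ᵇ X₁ := .ofNormedAddCommGroup (fun t => (1 + (t : ℂ) * Complex.I - θ)⁻¹ • g₁ t)
    ((Continuous.inv₀ (by fun_prop) n1).smul g₁.continuous) _ bd1
  -- Compactness bounds the quotient near `θ`; elsewhere `|z - θ|` is bounded below and `f` is
  -- bounded.
  have hbdd : ∃ N : ℝ, ∀ z, ‖dslope f θ z‖ ≤ N := by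
    obtain ⟨ε, hε, hball⟩ := Metric.nhds_basis_closedBall.mem_iff.1 hnhds
    obtain ⟨N, hN⟩ := (isCompact_closedBall (θ : ℂ) ε).exists_bound_of_continuousOn
      (hc'.mono (hball.trans hsub))
    refine ⟨max N (ε⁻¹ * M), fun z => ?_⟩
    by_cases hz : z ∈ Metric.closedBall (θ : ℂ) ε
    · exact le_max_of_le_left (hN z hz)
    · have hlt : ε < ‖z - θ‖ := by simpa [dist_eq_norm] using hz
      have hne : z ≠ θ := fun e => by
        rw [e, sub_self, norm_zero] at hlt; exact absurd hlt hε.not_gt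
      rw [hF z hne, norm_smul, norm_inv]
      exact le_max_of_le_right
        (mul_le_mul (inv_anti₀ hε hlt.le) (hM z) (norm_nonneg _) (by positivity))
  refine ⟨⟨(dslope f θ, k₀, k₁), fun z hz => ?_, hbdd, hc', hd', fun t => ?_, fun t => ?_⟩,
    dslope_same f (θ : ℂ), ?_⟩
  · have hne : z ≠ θ := by rintro rfl; exact hz (hsub hmem)
    simp [hF z hne, hz0 z hz]
  · simp [hF _ (sub_ne_zero.1 (n0 t)), k₀, h0]
  · simp [hF _ (sub_ne_zero.1 (n1 t)), k₁, h1]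
  · have hpos : 0 ≤ r⁻¹ := by positivity
    change max ‖k₀‖ ‖k₁‖ ≤ r⁻¹ * max ‖g₀‖ ‖g₁‖
    rw [mul_max_of_nonneg _ _ hpos]
    exact max_le_max (BoundedContinuousFunction.norm_ofNormedAddCommGroup_le _ (by positivity) bd0)
      (BoundedContinuousFunction.norm_ofNormedAddCommGroup_le _ (by positivity) bd1)

/-! ### Lifting real-linear operators to `𝓗` -/

/-- Chain rule for `v ∘ f ∘ σ`, where `σ` is a continuous involution of the field `ℂ` and `v` is
continuous and `σ`-semilinear. -/
lemma hasDerivAt_semilinear_comp {E : Type*} [NormedAddCommGroup E] [NormedSpace ℂ E]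
    {σ : ℂ →+* ℂ} (hσ : Continuous σ) (hσσ : ∀ z, σ (σ z) = z) {v : E →ₗ[ℝ] E}
    (hv : Continuous v) (hvσ : ∀ (c : ℂ) x, v (c • x) = σ c • v x) {f : ℂ → E} {f' : E} {z : ℂ}
    (hf : HasDerivAt f f' (σ z)) : HasDerivAt (fun w => v (f (σ w))) (v f') z := by
  rw [hasDerivAt_iff_tendsto_slope] at hf ⊢
  have hlim : Tendsto σ (𝓝[≠] z) (𝓝[≠] (σ z)) :=
    hσ.continuousAt.continuousWithinAt.tendsto_nhdsWithin fun w hw => σ.injective.ne hw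
  -- Semilinearity takes the factor `(σ w - σ z)⁻¹` out of `v` as `(w - z)⁻¹`, so `v` maps slopes of
  -- `f` to slopes of the composite.
  refine ((hv.tendsto f').comp (hf.comp hlim)).congr fun w => ?_
  simp [slope_def_module, hvσ, hσσ]

/-- A semilinear operator on the scale acts on `𝓗`. -/
lemma IsOperatorOnScale.exists_semilinear_lift {v : X.Sum →ₗ[ℝ] X.Sum}
    (hv : X.IsOperatorOnScale v) {σ : ℂ →+* ℂ} (hσ : Continuous σ) (hσσ : ∀ z, σ (σ z) = z)
    (hσre : ∀ z, (σ z).re = z.re) (hσr : ∀ r : ℝ, σ r = r)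
    (hvσ : ∀ (c : ℂ) x, v (c • x) = σ c • v x) {θ : ℝ} (hθ₀ : 0 < θ) (hθ₁ : θ < 1) :
    ∃ C : ℝ, 0 ≤ C ∧ ∀ g : X.calderon, ∃ h : X.calderon, X.eval θ h = v (X.eval θ g) ∧
      X.evalDeriv θ h = v (X.evalDeriv θ g) ∧ X.calderonNorm h ≤ C * X.calderonNorm g := by
  have hvc := hv.continuous
  obtain ⟨K, hK⟩ := hv.exists_bound
  obtain ⟨v₀, hv₀⟩ := hv.exists_restrict₀
  obtain ⟨v₁, hv₁⟩ := hv.exists_restrict₁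
  have hC : 0 ≤ max ‖v₀‖ ‖v₁‖ := le_max_of_le_left (norm_nonneg _)
  refine ⟨max ‖v₀‖ ‖v₁‖, hC, fun g => ?_⟩
  have hgd : ∀ z ∈ Complex.re ⁻¹' Ioo (0 : ℝ) 1,
      HasDerivAt (fun w => v (g.1.1 (σ w))) (v (deriv g.1.1 (σ z))) z := fun z hz =>
    hasDerivAt_semilinear_comp hσ hσσ hvc hvσ
      (calderon_differentiableAt g (by simpa [hσre] using hz)).hasDerivAt
  have hderiv := (hgd _ (ofReal_mem_strip hθ₀ hθ₁)).deriv
  rw [hσr] at hderiv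
  obtain ⟨⟨f, g₀, g₁⟩, hz0, ⟨M, hM⟩, hc, hd, h0, h1⟩ := g
  dsimp only at hz0 hM hc hd h0 h1 hgd hderiv
  -- `σ` preserves real parts, hence maps each edge to itself; `s` is the induced reparametrization.
  let s : ℝ → ℝ := fun t => (σ ((t : ℂ) * Complex.I)).im
  have hs : Continuous s := by fun_prop
  have hs0 : ∀ t : ℝ, σ ((t : ℂ) * Complex.I) = (s t : ℂ) * Complex.I := fun t => by
    exact Complex.ext (by rw [hσre]; simp) (by simp [s])
  have hs1 : ∀ t : ℝ, σ (1 + (t : ℂ) * Complex.I) = 1 + (s t : ℂ) * Complex.I := fun t => by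
    rw [map_add, map_one, hs0]
  have bd0 : ∀ t, ‖v₀ (g₀ (s t))‖ ≤ ‖v₀‖ * ‖g₀‖ := fun t =>
    v₀.le_opNorm_of_le (g₀.norm_coe_le_norm _)
  have bd1 : ∀ t, ‖v₁ (g₁ (s t))‖ ≤ ‖v₁‖ * ‖g₁‖ := fun t =>
    v₁.le_opNorm_of_le (g₁.norm_coe_le_norm _)
  let k₀ : ℝ →ᵇ X₀ := .ofNormedAddCommGroup (fun t => v₀ (g₀ (s t))) (by fun_prop) _ bd0
  let k₁ : ℝ →ᵇ X₁ := .ofNormedAddCommGroup (fun t => v₁ (g₁ (s t))) (by fun_prop) _ bd1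
  refine ⟨⟨(fun z => v (f (σ z)), k₀, k₁), fun z hz => ?_, ⟨|K| * M, fun z => ?_⟩, ?_,
    fun z hz => (hgd z hz).differentiableAt.differentiableWithinAt, fun t => ?_, fun t => ?_⟩,
    congrArg (fun z => v (f z)) (hσr θ), hderiv, ?_⟩
  · have : σ z ∉ Complex.re ⁻¹' Icc (0 : ℝ) 1 := by simpa [hσre] using hz
    simp [hz0 _ this]
  · exact (hK _).trans (mul_le_mul (le_abs_self K) (hM _) (norm_nonneg _) (abs_nonneg K))
  · exact hvc.comp_continuousOn (hc.comp hσ.continuousOn fun z hz => by simpa [hσre] using hz)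
  · simp [hs0, h0, k₀, hv₀]
  · simp only [hs1, h1, ← hv₁]; rfl
  · change max ‖k₀‖ ‖k₁‖ ≤ max ‖v₀‖ ‖v₁‖ * max ‖g₀‖ ‖g₁‖
    refine max_le ?_ ?_
    · exact (BoundedContinuousFunction.norm_ofNormedAddCommGroup_le _ (by positivity) bd0).trans
        (mul_le_mul (le_max_left _ _) (le_max_left _ _) (norm_nonneg _) hC)
    · exact (BoundedContinuousFunction.norm_ofNormedAddCommGroup_le _ (by positivity) bd1).trans
        (mul_le_mul (le_max_right _ _) (le_max_right _ _) (norm_nonneg _) hC)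

/-- The map `x ↦ (u x + ε i u (i x)) / 2`. For `ε = -1` and `ε = 1` these are the complex linear
and the conjugate linear part of `u`. -/
def part (u : X.Sum →ₗ[ℝ] X.Sum) (ε : ℝ) : X.Sum →ₗ[ℝ] X.Sum where
  toFun x := (2⁻¹ : ℂ) • (u x + (ε * Complex.I) • u (Complex.I • x))
  map_add' x y := by simp only [smul_add, map_add]; abel
  map_smul' r x := by
    have e (c : ℂ) (y : X.Sum) : c • r • y = r • c • y := smul_comm c r y
    simp only [e, map_smul, smul_add, RingHom.id_apply]

lemma IsOperatorOnScale.part {u : X.Sum →ₗ[ℝ] X.Sum} (hu : X.IsOperatorOnScale u) (ε : ℝ) :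
    X.IsOperatorOnScale (part u ε) := by
  obtain ⟨v₀, h₀⟩ := hu.exists_restrict₀
  obtain ⟨v₁, h₁⟩ := hu.exists_restrict₁
  let J₀ (c : ℂ) : X₀ →L[ℝ] X₀ := (c • ContinuousLinearMap.id ℂ X₀).restrictScalars ℝ
  let J₁ (c : ℂ) : X₁ →L[ℝ] X₁ := (c • ContinuousLinearMap.id ℂ X₁).restrictScalars ℝ
  refine .of_restrict ((J₀ 2⁻¹).comp (v₀ + (J₀ (ε * Complex.I)).comp (v₀.comp (J₀ Complex.I))))
    ((J₁ 2⁻¹).comp (v₁ + (J₁ (ε * Complex.I)).comp (v₁.comp (J₁ Complex.I)))) ?_ ?_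
  · intro x
    simp [J₀, CompatibleCouple.part, h₀]
  · intro x
    simp [J₁, CompatibleCouple.part, h₁]

/-- The scalar on the right is `c` for `ε = -1` and its conjugate for `ε = 1`. Expand in `u x` and
`u (i x)`: only the coefficient of the latter needs `ε² = 1` and `i² = -1`. -/
lemma part_smul (u : X.Sum →ₗ[ℝ] X.Sum) {ε : ℝ} (hε : ε * ε = 1) (c : ℂ) (x : X.Sum) :
    part u ε (c • x) = (c.re - ε * c.im * Complex.I : ℂ) • part u ε x := by
  have hr (r : ℝ) (y : X.Sum) : u ((r : ℂ) • y) = (r : ℂ) • u y := by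
    simpa only [Complex.coe_smul] using u.map_smul r y
  have hc : c • x = (c.re : ℂ) • x + (c.im : ℂ) • (Complex.I • x) := by
    rw [smul_smul, ← add_smul, Complex.re_add_im]
  have hic : Complex.I • c • x = (c.re : ℂ) • (Complex.I • x) + ((-c.im : ℝ) : ℂ) • x := by
    rw [smul_smul, smul_smul, ← add_smul]
    congr 1
    apply Complex.ext <;> simp
  have hε' : (ε : ℂ) * ε = 1 := by exact_mod_cast hε
  have hI : Complex.I * Complex.I = -1 := Complex.I_mul_I
  change (2⁻¹ : ℂ) • (u (c • x) + (ε * Complex.I) • u (Complex.I • c • x)) =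
    (c.re - ε * c.im * Complex.I : ℂ) •
      (2⁻¹ : ℂ) • (u x + (ε * Complex.I) • u (Complex.I • x))
  rw [hic, hc, map_add, map_add, hr, hr, hr, hr]
  generalize u x = a
  generalize u (Complex.I • x) = b
  push_cast
  match_scalars
  · ring
  · linear_combination (-(c.im : ℂ) / 2) * hε' - (ε * ε * c.im : ℂ) / 2 * (-hI)

lemma part_neg_one_add_part_one (u : X.Sum →ₗ[ℝ] X.Sum) (x : X.Sum) :
    part u (-1) x + part u 1 x = u x := by
  change (2⁻¹ : ℂ) • (u x + (((-1 : ℝ) : ℂ) * Complex.I) • u (Complex.I • x)) +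
    (2⁻¹ : ℂ) • (u x + (((1 : ℝ) : ℂ) * Complex.I) • u (Complex.I • x)) = u x
  push_cast
  module

/-- A real-linear operator on the scale acts on `𝓗`, compatibly with `δ_θ` and `δ'_θ`. -/
lemma IsOperatorOnScale.exists_lift {u : X.Sum →ₗ[ℝ] X.Sum} (hu : X.IsOperatorOnScale u) {θ : ℝ}
    (hθ₀ : 0 < θ) (hθ₁ : θ < 1) :
    ∃ C : ℝ, 0 ≤ C ∧ ∀ g : X.calderon, ∃ h : X.calderon, X.eval θ h = u (X.eval θ g) ∧
      X.evalDeriv θ h = u (X.evalDeriv θ g) ∧ X.calderonNorm h ≤ C * X.calderonNorm g := by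
  obtain ⟨C, hC, hL⟩ := (hu.part (-1)).exists_semilinear_lift (σ := RingHom.id ℂ) continuous_id
    (fun _ => rfl) (fun _ => rfl) (fun _ => rfl) (fun c x => by
      rw [part_smul u (by norm_num)]
      congr 1
      apply Complex.ext <;> simp) hθ₀ hθ₁
  obtain ⟨C', hC', hA⟩ := (hu.part 1).exists_semilinear_lift (σ := starRingEnd ℂ)
    Complex.continuous_conj Complex.conj_conj Complex.conj_re Complex.conj_ofReal (fun c x => by
      rw [part_smul u (by norm_num)]
      congr 1
      apply Complex.ext <;> simp) hθ₀ hθ₁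
  refine ⟨C + C', by positivity, fun g => ?_⟩
  obtain ⟨h, h1, h2, h3⟩ := hL g
  obtain ⟨k, k1, k2, k3⟩ := hA g
  refine ⟨h + k, ?_, ?_, ?_⟩
  · rw [map_add, h1, k1, part_neg_one_add_part_one]
  · rw [evalDeriv_add hθ₀ hθ₁, h2, k2, part_neg_one_add_part_one]
  · exact (calderonNorm_add_le _ _).trans ((add_le_add h3 k3).trans_eq (by ring))

/-! ### The interpolation norm -/

lemma interpNorm_nonneg {θ : ℝ} (x : X.interp θ) : 0 ≤ X.interpNorm θ x := by
  refine Real.sInf_nonneg ?_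
  rintro _ ⟨g, -, rfl⟩
  exact calderonNorm_nonneg g

lemma interpNorm_le {θ : ℝ} {x : X.interp θ} {g : X.calderon} (h : X.eval θ g = x) :
    X.interpNorm θ x ≤ X.calderonNorm g := by
  refine csInf_le ⟨0, ?_⟩ (mem_image_of_mem _ h)
  rintro _ ⟨g, -, rfl⟩
  exact calderonNorm_nonneg g

lemma interpNorm_smul_le {θ : ℝ} (c : ℂ) (x : X.interp θ) :
    X.interpNorm θ (c • x) ≤ ‖c‖ * X.interpNorm θ x := by
  have hne : (X.calderonNorm '' {g | X.eval θ g = x}).Nonempty := by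
    obtain ⟨g, hg⟩ := x.2
    exact ⟨_, g, hg, rfl⟩
  rw [interpNorm, interpNorm, ← smul_eq_mul ‖c‖, ← Real.sInf_smul_of_nonneg (norm_nonneg c)]
  refine le_csInf (hne.image _) ?_
  rintro _ ⟨_, ⟨g, hg, rfl⟩, rfl⟩
  have h : X.eval θ (c • g) = ((c • x : X.interp θ) : X.Sum) := by
    rw [map_smul, hg]; rfl
  exact (interpNorm_le h).trans_eq (calderonNorm_smul c g)

lemma interpNorm_smul {θ : ℝ} (c : ℂ) (x : X.interp θ) :
    X.interpNorm θ (c • x) = ‖c‖ * X.interpNorm θ x := by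
  refine le_antisymm (interpNorm_smul_le c x) ?_
  rcases eq_or_ne c 0 with rfl | hc
  · simpa using interpNorm_nonneg _
  · have h := interpNorm_smul_le c⁻¹ (c • x)
    rw [inv_smul_smul₀ hc, norm_inv] at h
    rwa [← le_inv_mul_iff₀ (norm_pos_iff.2 hc)]

/-! ### Quasi-additivity and commutators of `Ω_θ` -/

section Selection

variable {θ : ℝ} {B : X.interp θ → X.calderon}

lemma IsBoundedSelection.exists_nonneg_bound (hB : X.IsBoundedSelection θ B) :
    ∃ C : ℝ, 0 ≤ C ∧ ∀ x, X.calderonNorm (B x) ≤ C * X.interpNorm θ x := by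
  obtain ⟨C, hC⟩ := hB.bounded
  exact ⟨|C|, abs_nonneg C, fun x =>
    (hC x).trans (mul_le_mul_of_nonneg_right (le_abs_self C) (interpNorm_nonneg x))⟩

lemma IsBoundedSelection.interpNorm_eq_zero_iff (hB : X.IsBoundedSelection θ B) (hθ₀ : 0 < θ)
    (hθ₁ : θ < 1) (x : X.interp θ) : X.interpNorm θ x = 0 ↔ x = 0 := by
  constructor
  · intro h
    obtain ⟨C, hC⟩ := hB.bounded
    have h0 := eval_eq_zero_of_calderonNorm_eq_zero hθ₀ hθ₁ (B x)
      (le_antisymm (by simpa [h] using hC x) (calderonNorm_nonneg _))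
    rw [hB.eval_eq] at h0
    exact Subtype.ext h0
  · rintro rfl
    simpa using interpNorm_smul (0 : ℂ) (0 : X.interp θ)

/-- `B x + B y` is a competitor in the infimum for `x + y`. The constant of `B` is good enough, as
only a quasi-norm is wanted. -/
lemma IsBoundedSelection.exists_interpNorm_add_le (hB : X.IsBoundedSelection θ B) :
    ∃ C : ℝ, 0 ≤ C ∧ ∀ x y : X.interp θ,
      X.interpNorm θ (x + y) ≤ C * (X.interpNorm θ x + X.interpNorm θ y) := by
  obtain ⟨C, hC0, hC⟩ := hB.exists_nonneg_bound
  refine ⟨C, hC0, fun x y => ?_⟩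
  have h : X.eval θ (B x + B y) = ((x + y : X.interp θ) : X.Sum) := by
    rw [map_add, hB.eval_eq, hB.eval_eq]; rfl
  calc _ ≤ X.calderonNorm (B x + B y) := interpNorm_le h
    _ ≤ C * X.interpNorm θ x + C * X.interpNorm θ y :=
      (calderonNorm_add_le _ _).trans (add_le_add (hC x) (hC y))
    _ = _ := by ring

lemma IsBoundedSelection.centralizer_smul (hB : X.IsBoundedSelection θ B) (hθ₀ : 0 < θ)
    (hθ₁ : θ < 1) (c : ℂ) (x : X.interp θ) :
    X.centralizer θ B (c • x) = c • X.centralizer θ B x := by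
  rw [centralizer, hB.homogeneous, evalDeriv_smul hθ₀ hθ₁, centralizer]

/-- The derivative at `θ` of `g ∈ 𝓗` differs from `Ω_θ(g(θ))` by an element of `X_θ` whose norm is
controlled by that of `g`. -/
lemma IsBoundedSelection.exists_evalDeriv_sub_centralizer [CompleteSpace X₀] [CompleteSpace X₁]
    (hB : X.IsBoundedSelection θ B) (hθ₀ : 0 < θ) (hθ₁ : θ < 1) :
    ∃ C : ℝ, 0 ≤ C ∧ ∀ (g : X.calderon) (x : X.interp θ), X.eval θ g = x →
      ∃ y : X.interp θ, (y : X.Sum) = X.evalDeriv θ g - X.centralizer θ B x ∧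
        X.interpNorm θ y ≤ C * X.calderonNorm g := by
  obtain ⟨C, hC0, hC⟩ := hB.exists_nonneg_bound
  obtain ⟨K, hK0, hK⟩ := exists_eval_eq_evalDeriv (X := X) hθ₀ hθ₁
  refine ⟨K * (1 + C), by positivity, fun g x hg => ?_⟩
  obtain ⟨h, h1, h2⟩ := hK (g - B x) (by rw [map_sub, hg, hB.eval_eq, sub_self])
  refine ⟨⟨X.eval θ h, h, rfl⟩, ?_, ?_⟩
  · rw [centralizer, ← evalDeriv_sub hθ₀ hθ₁]; exact h1
  · calc _ ≤ X.calderonNorm h := interpNorm_le rfl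
      _ ≤ K * X.calderonNorm (g - B x) := h2
      _ ≤ K * (X.calderonNorm g + C * X.calderonNorm g) :=
        mul_le_mul_of_nonneg_left ((calderonNorm_sub_le _ _).trans (add_le_add le_rfl
          ((hC x).trans (mul_le_mul_of_nonneg_left (interpNorm_le hg) hC0)))) hK0
      _ = _ := by ring

/-- `Ω_θ` is quasi-additive. -/
lemma IsBoundedSelection.exists_centralizer_add [CompleteSpace X₀] [CompleteSpace X₁]
    (hB : X.IsBoundedSelection θ B) (hθ₀ : 0 < θ) (hθ₁ : θ < 1) :
    ∃ C : ℝ, 0 ≤ C ∧ ∀ x x' : X.interp θ, ∃ y : X.interp θ,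
      (y : X.Sum) =
        X.centralizer θ B x + X.centralizer θ B x' - X.centralizer θ B (x + x') ∧
      X.interpNorm θ y ≤ C * (X.interpNorm θ x + X.interpNorm θ x') := by
  obtain ⟨C, hC0, hC⟩ := hB.exists_nonneg_bound
  obtain ⟨K, hK0, hK⟩ := hB.exists_evalDeriv_sub_centralizer hθ₀ hθ₁
  refine ⟨K * C, by positivity, fun x x' => ?_⟩
  obtain ⟨y, hy, hyn⟩ := hK (B x + B x') (x + x') (by rw [map_add, hB.eval_eq, hB.eval_eq]; rfl)
  refine ⟨y, by rw [hy, evalDeriv_add hθ₀ hθ₁]; rfl, hyn.trans ?_⟩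
  rw [mul_assoc, mul_add]
  exact mul_le_mul_of_nonneg_left ((calderonNorm_add_le _ _).trans (add_le_add (hC x) (hC x'))) hK0

lemma IsBoundedSelection.exists_interpNorm_apply_le (hB : X.IsBoundedSelection θ B)
    {u : X.Sum →ₗ[ℝ] X.Sum} (hu : X.IsOperatorOnScale u) (hθ₀ : 0 < θ) (hθ₁ : θ < 1) :
    ∃ C : ℝ, 0 ≤ C ∧ ∀ x : X.interp θ, ∃ y : X.interp θ, (y : X.Sum) = u x ∧
      X.interpNorm θ y ≤ C * X.interpNorm θ x := by
  obtain ⟨C, hC0, hC⟩ := hB.exists_nonneg_bound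
  obtain ⟨K, hK0, hK⟩ := hu.exists_lift hθ₀ hθ₁
  refine ⟨K * C, by positivity, fun x => ?_⟩
  obtain ⟨h, h1, -, h3⟩ := hK (B x)
  refine ⟨⟨X.eval θ h, h, rfl⟩, by rw [← hB.eval_eq x, ← h1], (interpNorm_le rfl).trans ?_⟩
  rw [mul_assoc]
  exact h3.trans (mul_le_mul_of_nonneg_left (hC x) hK0)

/-- The commutator of `Ω_θ` with an operator on the scale is bounded on `X_θ`. -/
lemma IsBoundedSelection.exists_commutator [CompleteSpace X₀] [CompleteSpace X₁]
    (hB : X.IsBoundedSelection θ B) {u : X.Sum →ₗ[ℝ] X.Sum} (hu : X.IsOperatorOnScale u)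
    (hθ₀ : 0 < θ) (hθ₁ : θ < 1) :
    ∃ C : ℝ, 0 ≤ C ∧ ∀ x x' : X.interp θ, (x' : X.Sum) = u x → ∃ y : X.interp θ,
      (y : X.Sum) = u (X.centralizer θ B x) - X.centralizer θ B x' ∧
      X.interpNorm θ y ≤ C * X.interpNorm θ x := by
  obtain ⟨C, hC0, hC⟩ := hB.exists_nonneg_bound
  obtain ⟨K, hK0, hK⟩ := hu.exists_lift hθ₀ hθ₁
  obtain ⟨L, hL0, hL⟩ := hB.exists_evalDeriv_sub_centralizer hθ₀ hθ₁
  refine ⟨L * (K * C), by positivity, fun x x' hx' => ?_⟩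
  obtain ⟨h, h1, h2, h3⟩ := hK (B x)
  -- The lift `h` of `B x` and `B x'` share the value `u x` at `θ`, and `h` has derivative `u (Ω_θ
  -- x)` there.
  obtain ⟨y, hy, hyn⟩ := hL h x' (by rw [h1, hB.eval_eq, hx'])
  refine ⟨y, by rw [hy, h2]; rfl, hyn.trans ?_⟩
  rw [mul_assoc, mul_assoc]
  exact mul_le_mul_of_nonneg_left (h3.trans (mul_le_mul_of_nonneg_left (hC x) hK0)) hL0

/-! ### The derived space and its quasi-norm -/

/-- The derived space as a complex subspace of `Σ × X_θ`. -/
def derivedSubmodule [CompleteSpace X₀] [CompleteSpace X₁] (hB : X.IsBoundedSelection θ B)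
    (hθ₀ : 0 < θ) (hθ₁ : θ < 1) : Submodule ℂ (X.Sum × X.interp θ) where
  carrier := X.derived θ (X.centralizer θ B)
  zero_mem' := by
    have h := hB.centralizer_smul hθ₀ hθ₁ 0 0
    rw [zero_smul, zero_smul] at h
    change (0 : X.Sum) - X.centralizer θ B 0 ∈ X.interp θ
    rw [h, sub_zero]
    exact zero_mem _
  add_mem' := by
    rintro ⟨w, x⟩ ⟨w', x'⟩ hw hw'
    obtain ⟨C, -, hC⟩ := hB.exists_centralizer_add hθ₀ hθ₁
    obtain ⟨y, hy, -⟩ := hC x x'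
    change w + w' - X.centralizer θ B (x + x') ∈ X.interp θ
    have e : w + w' - X.centralizer θ B (x + x') =
        (w - X.centralizer θ B x) + (w' - X.centralizer θ B x') + y := by rw [hy]; abel
    rw [e]
    exact add_mem (add_mem hw hw') y.2
  smul_mem' := by
    rintro c ⟨w, x⟩ hw
    change c • w - X.centralizer θ B (c • x) ∈ X.interp θ
    rw [hB.centralizer_smul hθ₀ hθ₁, ← smul_sub]
    exact Submodule.smul_mem _ c hw

lemma isQuasiNorm_derivedNorm [CompleteSpace X₀] [CompleteSpace X₁]
    (hB : X.IsBoundedSelection θ B) (hθ₀ : 0 < θ) (hθ₁ : θ < 1) :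
    IsQuasiNorm fun p : derivedSubmodule hB hθ₀ hθ₁ =>
      X.derivedNorm θ (X.centralizer θ B) ⟨p.1, p.2⟩ where
  nonneg _ := add_nonneg (interpNorm_nonneg _) (interpNorm_nonneg _)
  eq_zero_iff := by
    rintro ⟨⟨w, x⟩, hw⟩
    have hΩ : X.centralizer θ B 0 = 0 := by
      simpa only [zero_smul] using hB.centralizer_smul hθ₀ hθ₁ 0 0
    rw [derivedNorm, add_eq_zero_iff_of_nonneg (interpNorm_nonneg _) (interpNorm_nonneg _),
      hB.interpNorm_eq_zero_iff hθ₀ hθ₁, hB.interpNorm_eq_zero_iff hθ₀ hθ₁]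
    dsimp only
    constructor
    · rintro ⟨rfl, h⟩
      have h' : w - X.centralizer θ B 0 = 0 := congrArg Subtype.val h
      rw [hΩ, sub_zero] at h'
      subst h'
      rfl
    · intro h
      obtain ⟨rfl, rfl⟩ := Prod.mk.inj (congrArg Subtype.val h)
      exact ⟨rfl, Subtype.ext (by
        change (0 : X.Sum) - X.centralizer θ B 0 = 0
        rw [hΩ, sub_zero])⟩
  smul := by
    rintro c ⟨⟨w, x⟩, hw⟩
    have e : (⟨c • w - X.centralizer θ B (c • x),
        ((derivedSubmodule hB hθ₀ hθ₁).smul_mem c hw :)⟩ : X.interp θ) =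
        c • ⟨w - X.centralizer θ B x, hw⟩ :=
      Subtype.ext (by
        change c • w - X.centralizer θ B (c • x) = c • (w - X.centralizer θ B x)
        rw [hB.centralizer_smul hθ₀ hθ₁, ← smul_sub])
    change X.interpNorm θ (c • x) + X.interpNorm θ ⟨c • w - X.centralizer θ B (c • x), _⟩ =
      ‖c‖ * (X.interpNorm θ x + X.interpNorm θ ⟨w - X.centralizer θ B x, hw⟩)
    rw [e, interpNorm_smul, interpNorm_smul, mul_add]
  add_le := by
    obtain ⟨C, hC0, hC⟩ := hB.exists_centralizer_add hθ₀ hθ₁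
    obtain ⟨K, hK0, hK⟩ := hB.exists_interpNorm_add_le
    -- `K` comes from `x + x'`. The second component is a sum of three terms: splitting off the
    -- defect of `Ω_θ` gives `K * C`, and separating the other two gives `K * K`.
    refine ⟨K + K * K + K * C, ?_⟩
    rintro ⟨⟨w, x⟩, hw⟩ ⟨⟨w', x'⟩, hw'⟩
    obtain ⟨y, hy, hyn⟩ := hC x x'
    have e : (⟨w + w' - X.centralizer θ B (x + x'),
        ((derivedSubmodule hB hθ₀ hθ₁).add_mem hw hw' :)⟩ : X.interp θ) =
        (⟨w - X.centralizer θ B x, hw⟩ + ⟨w' - X.centralizer θ B x', hw'⟩) + y :=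
      Subtype.ext (by
        change w + w' - X.centralizer θ B (x + x') =
          (w - X.centralizer θ B x) + (w' - X.centralizer θ B x') + (y : X.Sum)
        rw [hy]; abel)
    change X.interpNorm θ (x + x') +
        X.interpNorm θ ⟨w + w' - X.centralizer θ B (x + x'), _⟩ ≤
      (K + K * K + K * C) * ((X.interpNorm θ x + X.interpNorm θ ⟨w - X.centralizer θ B x, hw⟩) +
        (X.interpNorm θ x' + X.interpNorm θ ⟨w' - X.centralizer θ B x', hw'⟩))
    rw [e]
    have h1 := hK x x'
    set a : X.interp θ := ⟨w - X.centralizer θ B x, hw⟩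
    set a' : X.interp θ := ⟨w' - X.centralizer θ B x', hw'⟩
    have h2 := hK (a + a') y
    have h3 := mul_le_mul_of_nonneg_left (hK a a') hK0
    have h4 := mul_le_mul_of_nonneg_left hyn hK0
    have n := interpNorm_nonneg x
    have n' := interpNorm_nonneg x'
    have m := interpNorm_nonneg a
    have m' := interpNorm_nonneg a'
    have p1 := mul_nonneg (mul_nonneg hK0 hK0) (add_nonneg n n')
    have p2 := mul_nonneg (mul_nonneg hK0 hC0) (add_nonneg m m')
    have p3 := mul_nonneg hK0 (add_nonneg m m')
    linarith

end Selection

end CompatibleCouple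
end

/-! ### The complex structure `(u, u)` -/

theorem proposition2p6 {X₀ X₁ V : Type*}
    [NormedAddCommGroup X₀] [NormedSpace ℂ X₀] [CompleteSpace X₀]
    [NormedAddCommGroup X₁] [NormedSpace ℂ X₁] [CompleteSpace X₁]
    [AddCommGroup V] [Module ℂ V] [TopologicalSpace V] [IsTopologicalAddGroup V]
    [ContinuousSMul ℂ V] [T2Space V]
    (X : CompatibleCouple X₀ X₁ V) (θ : ℝ) (hθ₀ : 0 < θ) (hθ₁ : θ < 1)
    (B : X.interp θ → X.calderon) (hB : X.IsBoundedSelection θ B)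
    (u : X.Sum →ₗ[ℝ] X.Sum) (hu : X.IsOperatorOnScale u)
    (hu_sq : ∀ x ∈ X.interp θ, u (u x) = -x) :
    ∃ (D : Submodule ℂ (X.Sum × X.interp θ))
      (hD : (D : Set (X.Sum × X.interp θ)) = X.derived θ (X.centralizer θ B)),
      let q : D → ℝ := fun p => X.derivedNorm θ (X.centralizer θ B) ⟨p.1, hD ▸ p.2⟩
      IsQuasiNorm q ∧
      ∃ β : D →ₗ[ℝ] D,
        (∀ p : D, (β p).1.1 = u p.1.1 ∧ ((β p).1.2 : X.Sum) = u (p.1.2 : X.Sum)) ∧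
        IsComplexStructure q β := by
  refine ⟨CompatibleCouple.derivedSubmodule hB hθ₀ hθ₁, rfl,
    CompatibleCouple.isQuasiNorm_derivedNorm hB hθ₀ hθ₁, ?_⟩
  obtain ⟨C, hC0, hC⟩ := hB.exists_interpNorm_apply_le hu hθ₀ hθ₁
  obtain ⟨K, hK0, hK⟩ := hB.exists_commutator hu hθ₀ hθ₁
  obtain ⟨L, hL0, hL⟩ := hB.exists_interpNorm_add_le
  choose v hv hvC using hC
  -- Here `v` is `u` on `X_θ`. The witness is `u (w - Ω_θ x)` plus the commutator at `x`; it yields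
  -- both invariance and the bound.
  have key (w : X.Sum) (x : X.interp θ) (hw : w - X.centralizer θ B x ∈ X.interp θ) :
      ∃ y : X.interp θ, (y : X.Sum) = u w - X.centralizer θ B (v x) ∧
        X.interpNorm θ y ≤ L * (C * X.interpNorm θ ⟨w - X.centralizer θ B x, hw⟩ +
          K * X.interpNorm θ x) := by
    obtain ⟨y, hy, hyn⟩ := hK x (v x) (hv x)
    refine ⟨v ⟨w - X.centralizer θ B x, hw⟩ + y, ?_, (hL _ _).trans
      (mul_le_mul_of_nonneg_left (add_le_add (hvC _) hyn) hL0)⟩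
    rw [Submodule.coe_add, hv, hy, map_sub]
    abel
  have hmem (p : CompatibleCouple.derivedSubmodule hB hθ₀ hθ₁) :
      (u p.1.1, v p.1.2) ∈ CompatibleCouple.derivedSubmodule hB hθ₀ hθ₁ := by
    obtain ⟨y, hy, -⟩ := key _ _ p.2
    change u p.1.1 - X.centralizer θ B (v p.1.2) ∈ X.interp θ
    rw [← hy]
    exact y.2
  have hsq := hu.apply_apply_eq_neg hθ₀ hθ₁ hu_sq
  refine ⟨{ toFun := fun p => ⟨(u p.1.1, v p.1.2), hmem p⟩
            map_add' := fun p p' => Subtype.ext (Prod.ext (map_add u _ _) (Subtype.ext ?_))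
            map_smul' := fun r p => Subtype.ext (Prod.ext (map_smul u r _) (Subtype.ext ?_)) },
    fun p => ⟨rfl, hv _⟩, ⟨⟨C + L * C + L * K, fun p => ?_⟩, fun p =>
      Subtype.ext (Prod.ext (hsq _) (Subtype.ext ?_))⟩⟩
  · change (v (p.1.2 + p'.1.2) : X.Sum) = v p.1.2 + v p'.1.2
    rw [hv, hv, hv, ← map_add]; rfl
  · change (v (r • p.1.2) : X.Sum) = r • (v p.1.2 : X.Sum)
    rw [hv, hv, ← map_smul]; rfl
  · obtain ⟨y, hy, hyn⟩ := key _ _ p.2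
    have e : (⟨u p.1.1 - X.centralizer θ B (v p.1.2), hmem p⟩ : X.interp θ) = y :=
      Subtype.ext hy.symm
    change X.interpNorm θ (v p.1.2) +
        X.interpNorm θ ⟨u p.1.1 - X.centralizer θ B (v p.1.2), _⟩ ≤ (C + L * C + L * K) *
      (X.interpNorm θ p.1.2 + X.interpNorm θ ⟨p.1.1 - X.centralizer θ B p.1.2, p.2⟩)
    rw [e]
    have h1 := hvC p.1.2
    have n := CompatibleCouple.interpNorm_nonneg p.1.2
    have m := CompatibleCouple.interpNorm_nonneg (X := X) (θ := θ)
      ⟨p.1.1 - X.centralizer θ B p.1.2, p.2⟩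
    have p1 := mul_nonneg hC0 m
    have p2 := mul_nonneg (mul_nonneg hL0 hC0) n
    have p3 := mul_nonneg (mul_nonneg hL0 hK0) m
    linarith
  · change (v (v p.1.2) : X.Sum) = -(p.1.2 : X.Sum)
    rw [hv, hv, hsq]
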